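/- For a relation $R$ on a set $X$ and $a,b\subseteq X$ write $[R]a=\{x\mid \forall y\,(xRy\Rightarrow y\in a)\}$ and $a\Rightarrow_R b=\{x\mid \forall y\,(xRy \text{ and } y\in a \text{ imply } y\in b)\}$. A *general $⥽$-frame* is a tuple $\mathfrak G=(X,\preceq,\sqsubset,P)$ where $(X,\preceq)$ is a poset, $\sqsubset$ is a binary relation on $X$ such that $x\preceq y\sqsubset z$ implies $x\sqsubset z$, and $P$ is a collection of $\preceq$-upsets of $X$ containing $X$ and $\emptyset$ and closed under $\cap$, $\cup$, $\Rightarrow_{\preceq}$ and $\Rightarrow_{\sqsubset}$. It is *descriptive* if: (compact) for all $A\subseteq P$ and $B\subseteq\{X\setminus a\mid a\in P\}$, if $A\cup B$ has the finite intersection property then $\bigcap(A\cup B)\neq\emptyset$; ($\preceq$-refined) $x\not\preceq y$ implies that there is $a\in P$ with $x\in a$, $y\notin a$; ($\sqsubset$-refined) $x\not\sqsubset y$ implies that there are $a,b\in P$ with $x\in a\Rightarrow_{\sqsubset}b$, $y\in a$, $y\notin b$. A *general S4K-frame* is a tuple $\mathfrak F=(X,R_{\mathsf i},R_{\mathsf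 m},P)$ where $R_{\mathsf i}$ is a preorder on $X$, $R_{\mathsf m}$ is a binary relation on $X$, and $P$ is a Boolean subalgebra of the powerset of $X$ closed under $[R_{\mathsf i}]$ and $[R_{\mathsf m}]$. It is *descriptive* if it is differentiated ($x=y$ iff $x$ and $y$ belong to the same members of $P$), tight (for each $R\in\{R_{\mathsf i},R_{\mathsf m}\}$: $xRy$ iff for all $a\in P$, $x\in[R]a$ implies $y\in a$) and compact (every $A\subseteq P$ with the finite intersection property has $\bigcap A\neq\emptyset$). For a general S4K-frame $\mathfrak F=(X,R_{\mathsf i},R_{\mathsf m},P)$ define the general $⥽$-frame $\hat\rho\mathfrak F=([X],[R_{\mathsf i}],[R_{\mathsf m}^*],\hat\rho P)$ as follows. Let $x\,R_{\mathsf m}^*\,z$ iff $x R_{\mathsf i} y$ and $y R_{\mathsf m} z$ for some $y$. Let $[X]$ be the set of classes $[x]$ (clusters) of the equivalence relation $x\sim y$ iff $xR_{\mathsf i}y$ and $yR_{\mathsf i}x$; let $[x][R_{\mathsf i}][y]$ iff $xR_{\mathsf i}y$, and $[x][R_{\mathsf m}^*][y]$ iff $xR_{\mathsf m}^*y'$ for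 some $y'\sim y$. Let $\hat\rho P$ consist of the sets $[[R_{\mathsf i}]]\,c$ with $c\subseteq[X]$ such that $\bigcup c\in P$. For a general $⥽$-frame $\mathfrak G=(X,\preceq,\sqsubset,P)$ define the general S4K-frame $\hat\sigma\mathfrak G=(X,\preceq,\sqsubset,\hat\sigma P)$, where $\hat\sigma P$ is the Boolean subalgebra of the powerset of $X$ generated by $P$. **Proposition.** Both $\hat\rho$ and $\hat\sigma$ preserve descriptiveness: if $\mathfrak F$ is a descriptive general S4K-frame, then $\hat\rho\mathfrak F$ is a descriptive general $⥽$-frame; and if $\mathfrak G$ is a descriptive general $⥽$-frame, then $\hat\sigma\mathfrak G$ is a descriptive general S4K-frame. -/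

import Mathlib

/-! ### Operations on subsets induced by a relation -/

/-- `a` is upward closed under the relation `R`. -/
def RelUpset {X : Type*} (R : X → X → Prop) (a : Set X) : Prop :=
  ∀ x y, x ∈ a → R x y → y ∈ a

/-- The box operator `[R] a = {x | x R y implies y ∈ a}`. -/
def relBox {X : Type*} (R : X → X → Prop) (a : Set X) : Set X :=
  {x | ∀ y, R x y → y ∈ a}

/-- The binary implication induced by `R`:
`{x | x R y and y ∈ a imply y ∈ b}`. For the partial order of a frame this is the Heyting
implication of upsets, for its second relation it is the strict implication. -/
def relImp {X : Type*} (R : X → X → Prop) (a b : Set X) : Set X :=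
  {x | ∀ y, R x y → y ∈ a → y ∈ b}

/-- The finite intersection property (the empty intersection being the whole set). -/
def HasFIP {X : Type*} (S : Set (Set X)) : Prop :=
  ∀ T : Set (Set X), T ⊆ S → T.Finite → (⋂₀ T).Nonempty

/-! ### Strict implication frames -/

/-- A strict implication frame: a poset with a second relation `sq` such that
`x ≼ y ⊏ z` implies `x ⊏ z`. -/
structure StrictFrame (X : Type*) where
  le : X → X → Prop
  sq : X → X → Prop
  isPartialOrder : IsPartialOrder X le
  sq_of_le_of_sq : ∀ x y z, le x y → sq y z → sq x z

/-- A general strict implication frame: a strict implication frame with a collection `adm` of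
admissible upsets containing the whole set and the empty set, closed under intersection, union,
Heyting implication and strict implication. -/
structure GenStrictFrame (X : Type*) extends StrictFrame X where
  adm : Set (Set X)
  upset_of_adm : ∀ a ∈ adm, RelUpset le a
  univ_adm : Set.univ ∈ adm
  empty_adm : ∅ ∈ adm
  inter_adm : ∀ a ∈ adm, ∀ b ∈ adm, a ∩ b ∈ adm
  union_adm : ∀ a ∈ adm, ∀ b ∈ adm, a ∪ b ∈ adm
  imp_adm : ∀ a ∈ adm, ∀ b ∈ adm, relImp le a b ∈ adm
  simp_adm : ∀ a ∈ adm, ∀ b ∈ adm, relImp sq a b ∈ adm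

namespace GenStrictFrame

variable {X : Type*} (G : GenStrictFrame X)

def Compact : Prop :=
  ∀ A B : Set (Set X), A ⊆ G.adm → B ⊆ {c | ∃ a ∈ G.adm, c = aᶜ} →
    HasFIP (A ∪ B) → (⋂₀ (A ∪ B)).Nonempty

def LeRefined : Prop :=
  ∀ x y, ¬ G.le x y → ∃ a ∈ G.adm, x ∈ a ∧ y ∉ a

def SqRefined : Prop :=
  ∀ x y, ¬ G.sq x y → ∃ a ∈ G.adm, ∃ b ∈ G.adm, x ∈ relImp G.sq a b ∧ y ∈ a ∧ y ∉ b

structure Descriptive : Prop where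
  compact : G.Compact
  leRefined : G.LeRefined
  sqRefined : G.SqRefined

end GenStrictFrame

/-! ### S4K-frames -/

/-- An S4K-frame: a set with a preorder `Ri` and a binary relation `Rm`. -/
structure S4KFrame (X : Type*) where
  Ri : X → X → Prop
  Rm : X → X → Prop
  isPreorder : IsPreorder X Ri

attribute [instance] S4KFrame.isPreorder

/-- The condition `Ri ∘ Rm ⊆ Rm` singling out the S4BHL-frames (where `∘` is relational
composition in diagrammatic order). -/
def S4KFrame.IsBHL {X : Type*} (F : S4KFrame X) : Prop :=
  ∀ x y z, F.Ri x y → F.Rm y z → F.Rm x z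

/-- A general S4K-frame: an S4K-frame with a Boolean subalgebra `adm` of the powerset that is
closed under both box operators. -/
structure GenS4KFrame (X : Type*) extends S4KFrame X where
  adm : BooleanSubalgebra (Set X)
  boxI_adm : ∀ a ∈ adm, relBox Ri a ∈ adm
  boxM_adm : ∀ a ∈ adm, relBox Rm a ∈ adm

namespace GenS4KFrame

variable {X : Type*} (F : GenS4KFrame X)

def Differentiated : Prop :=
  ∀ x y, x = y ↔ ∀ a ∈ F.adm, (x ∈ a ↔ y ∈ a)

/-- Tightness of a relation `R` with respect to the admissible sets. -/
def TightFor (R : X → X → Prop) : Prop :=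
  ∀ x y, R x y ↔ ∀ a ∈ F.adm, x ∈ relBox R a → y ∈ a

def Compact : Prop :=
  ∀ A : Set (Set X), A ⊆ (F.adm : Set (Set X)) → HasFIP A → (⋂₀ A).Nonempty

structure Descriptive : Prop where
  differentiated : F.Differentiated
  tightI : F.TightFor F.Ri
  tightM : F.TightFor F.Rm
  compact : F.Compact

end GenS4KFrame

/-! ### From general strict implication frames to general S4K-frames -/

theorem relBox_compl_closure_mem {X : Type*} {P : Set (Set X)} (R : X → X → Prop)
    (huniv : Set.univ ∈ P) (hempty : ∅ ∈ P)
    (hinter : ∀ a ∈ P, ∀ b ∈ P, a ∩ b ∈ P) (hunion : ∀ a ∈ P, ∀ b ∈ P, a ∪ b ∈ P)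
    (himp : ∀ a ∈ P, ∀ b ∈ P, relImp R a b ∈ P)
    (c : Set X) (hc : c ∈ BooleanSubalgebra.closure P) : relBox R cᶜ ∈ P := by
  have hP : IsSublattice P := ⟨fun a ha b hb => hunion a ha b hb,
    fun a ha b hb => hinter a ha b hb⟩
  refine BooleanSubalgebra.closure_sdiff_sup_induction (p := fun c _ => relBox R cᶜ ∈ P)
    hP hempty huniv ?_ ?_ c hc
  · intro x hx y hy
    convert himp x hx y hy using 1
    ext w
    simp only [relBox, relImp, Set.mem_ofPred_eq, Set.mem_compl_iff, Set.mem_sdiff, not_and, not_not]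
  · intro x _ y _ h1 h2
    convert hinter _ h1 _ h2 using 1
    ext w
    simp only [relBox, Set.mem_ofPred_eq, Set.mem_compl_iff, Set.sup_eq_union, Set.mem_union,
      Set.mem_inter_iff, not_or, forall_and]

theorem GenStrictFrame.relBox_closure_mem {X : Type*} (G : GenStrictFrame X) {R : X → X → Prop}
    (himp : ∀ a ∈ G.adm, ∀ b ∈ G.adm, relImp R a b ∈ G.adm) (a : Set X)
    (ha : a ∈ BooleanSubalgebra.closure G.adm) :
    relBox R a ∈ BooleanSubalgebra.closure G.adm := by
  have h := relBox_compl_closure_mem R G.univ_adm G.empty_adm G.inter_adm G.union_adm himp aᶜ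
    (BooleanSubalgebra.compl_mem ha)
  rw [compl_compl] at h
  exact BooleanSubalgebra.subset_closure h

/-- The translation `σ̂`: the same set and relations, with the Boolean closure of the admissible
upsets in the powerset as admissible sets. -/
def GenStrictFrame.sigmaHat {X : Type*} (G : GenStrictFrame X) : GenS4KFrame X where
  Ri := G.le
  Rm := G.sq
  isPreorder := G.isPartialOrder.toIsPreorder
  adm := BooleanSubalgebra.closure G.adm
  boxI_adm := G.relBox_closure_mem G.imp_adm
  boxM_adm := G.relBox_closure_mem G.simp_adm

/-! ### From general S4K-frames to general strict implication frames -/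

namespace GenS4KFrame

variable {X : Type*} (F : GenS4KFrame X)

/-- The frame `F*`, in which `Rm` is replaced by `Rm* = Ri ∘ Rm`, that is,
`x Rm* z` iff `x Ri y` and `y Rm z` for some `y`. -/
def star : GenS4KFrame X where
  Ri := F.Ri
  Rm := Relation.Comp F.Ri F.Rm
  isPreorder := F.isPreorder
  adm := F.adm
  boxI_adm := F.boxI_adm
  boxM_adm := fun a ha => by
    convert F.boxI_adm _ (F.boxM_adm a ha) using 1
    ext x
    exact ⟨fun h y hy z hz => h z ⟨y, hy, hz⟩, fun h z ⟨y, hy, hz⟩ => h y hy z hz⟩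

theorem star_isBHL : F.star.IsBHL :=
  fun _ _ _ hxy ⟨w, hyw, hwz⟩ => ⟨w, F.isPreorder.trans _ _ _ hxy hyw, hwz⟩

/-- The set of `Ri`-clusters: the quotient of `X` by `x ∼ y` iff `x Ri y` and `y Ri x`. -/
def Cluster : Type _ := Antisymmetrization X F.Ri

/-- The cluster of a point. -/
def toCluster : X → F.Cluster := toAntisymmetrization F.Ri

theorem toCluster_eq_iff {x y : X} : F.toCluster x = F.toCluster y ↔ F.Ri x y ∧ F.Ri y x :=
  Quotient.eq (r := AntisymmRel.setoid X F.Ri)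

theorem toCluster_surjective : Function.Surjective F.toCluster :=
  fun A => Quotient.exists_rep (s := AntisymmRel.setoid X F.Ri) A

/-- The relation on clusters induced by `Ri`. -/
def clusterRi (A B : F.Cluster) : Prop :=
  ∃ x y, F.toCluster x = A ∧ F.toCluster y = B ∧ F.Ri x y

/-- The relation on clusters induced by `Rm`. For S4BHL-frames the choice of the representative
of the first cluster is irrelevant, see `clusterRm_iff`. -/
def clusterRm (A B : F.Cluster) : Prop :=
  ∃ x y, F.toCluster x = A ∧ F.toCluster y = B ∧ F.Rm x y

theorem clusterRi_iff {x y : X} :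
    F.clusterRi (F.toCluster x) (F.toCluster y) ↔ F.Ri x y := by
  constructor
  · rintro ⟨x', y', hx, hy, h⟩
    rw [toCluster_eq_iff] at hx hy
    exact F.isPreorder.trans _ _ _ hx.2 (F.isPreorder.trans _ _ _ h hy.1)
  · exact fun h => ⟨x, y, rfl, rfl, h⟩

theorem clusterRm_iff (hF : F.IsBHL) {x y : X} :
    F.clusterRm (F.toCluster x) (F.toCluster y) ↔
      ∃ y', F.toCluster y' = F.toCluster y ∧ F.Rm x y' := by
  constructor
  · rintro ⟨x', y', hx, hy, h⟩
    rw [toCluster_eq_iff] at hx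
    exact ⟨y', hy, hF _ _ _ hx.2 h⟩
  · rintro ⟨y', hy, h⟩
    exact ⟨x, y', rfl, hy, h⟩

/-- The sets `A` of clusters whose union `⋃ A = {x | the cluster of x is in A}` is admissible. -/
def clusterAdm : Set (Set F.Cluster) :=
  {A | F.toCluster ⁻¹' A ∈ F.adm}

/-- The admissible sets of `ρ̂ F`: the boxes, with respect to the order on clusters, of the
elements of `clusterAdm`. -/
def rhoAdm : Set (Set F.Cluster) :=
  {B | ∃ A ∈ F.clusterAdm, B = relBox F.clusterRi A}

theorem mem_rhoAdm_iff {B : Set F.Cluster} :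
    B ∈ F.rhoAdm ↔ RelUpset F.clusterRi B ∧ F.toCluster ⁻¹' B ∈ F.adm := by
  constructor
  · rintro ⟨A, hA, rfl⟩
    constructor
    · intro S T hS hST U hU
      obtain ⟨x, rfl⟩ := F.toCluster_surjective S
      obtain ⟨y, rfl⟩ := F.toCluster_surjective T
      obtain ⟨z, rfl⟩ := F.toCluster_surjective U
      rw [clusterRi_iff] at hST hU
      exact hS _ (F.clusterRi_iff.2 (F.isPreorder.trans _ _ _ hST hU))
    · convert F.boxI_adm _ hA using 1
      ext x
      constructor
      · exact fun h y hy => h _ (F.clusterRi_iff.2 hy)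
      · intro h S hS
        obtain ⟨y, rfl⟩ := F.toCluster_surjective S
        exact h y (F.clusterRi_iff.1 hS)
  · rintro ⟨hup, hB⟩
    refine ⟨B, hB, Set.ext fun S => ⟨fun h T hT => hup S T h hT, fun h => h S ?_⟩⟩
    obtain ⟨x, rfl⟩ := F.toCluster_surjective S
    exact F.clusterRi_iff.2 (F.isPreorder.refl x)

theorem isPartialOrder_clusterRi : IsPartialOrder F.Cluster F.clusterRi where
  refl S := by
    obtain ⟨x, rfl⟩ := F.toCluster_surjective S
    exact F.clusterRi_iff.2 (F.isPreorder.refl x)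
  trans S T U hST hTU := by
    obtain ⟨x, rfl⟩ := F.toCluster_surjective S
    obtain ⟨y, rfl⟩ := F.toCluster_surjective T
    obtain ⟨z, rfl⟩ := F.toCluster_surjective U
    rw [clusterRi_iff] at *
    exact F.isPreorder.trans _ _ _ hST hTU
  antisymm S T hST hTS := by
    obtain ⟨x, rfl⟩ := F.toCluster_surjective S
    obtain ⟨y, rfl⟩ := F.toCluster_surjective T
    rw [clusterRi_iff] at *
    exact F.toCluster_eq_iff.2 ⟨hST, hTS⟩

theorem preimage_relImp_clusterRi (A B : Set F.Cluster) :
    F.toCluster ⁻¹' relImp F.clusterRi A B =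
      relBox F.Ri ((F.toCluster ⁻¹' A)ᶜ ∪ F.toCluster ⁻¹' B) := by
  ext x
  constructor
  · intro h y hy
    by_cases hA : F.toCluster y ∈ A
    · exact Or.inr (h _ (F.clusterRi_iff.2 hy) hA)
    · exact Or.inl hA
  · intro h S hS hA
    obtain ⟨y, rfl⟩ := F.toCluster_surjective S
    exact (h y (F.clusterRi_iff.1 hS)).resolve_left fun h' => h' hA

theorem preimage_relImp_clusterRm (hF : F.IsBHL) (A B : Set F.Cluster) :
    F.toCluster ⁻¹' relImp F.clusterRm A B =
      relBox F.Rm ((F.toCluster ⁻¹' A)ᶜ ∪ F.toCluster ⁻¹' B) := by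
  ext x
  constructor
  · intro h y hy
    by_cases hA : F.toCluster y ∈ A
    · exact Or.inr (h _ ((F.clusterRm_iff hF).2 ⟨y, rfl, hy⟩) hA)
    · exact Or.inl hA
  · intro h S hS hA
    obtain ⟨y, rfl⟩ := F.toCluster_surjective S
    obtain ⟨y', hy', hxy⟩ := (F.clusterRm_iff hF).1 hS
    rw [← hy'] at hA ⊢
    exact (h y' hxy).resolve_left fun h' => h' hA

theorem clusterRm_of_clusterRi_of_clusterRm (hF : F.IsBHL) (S T U : F.Cluster)
    (hST : F.clusterRi S T) (hTU : F.clusterRm T U) : F.clusterRm S U := by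
  obtain ⟨x, rfl⟩ := F.toCluster_surjective S
  obtain ⟨y, rfl⟩ := F.toCluster_surjective T
  obtain ⟨z, rfl⟩ := F.toCluster_surjective U
  rw [clusterRi_iff] at hST
  rw [F.clusterRm_iff hF] at *
  obtain ⟨z', hz, hyz⟩ := hTU
  exact ⟨z', hz, hF _ _ _ hST hyz⟩

/-- For a general S4BHL-frame, the general strict implication frame on its clusters. -/
def clusterFrame (hF : F.IsBHL) : GenStrictFrame F.Cluster where
  le := F.clusterRi
  sq := F.clusterRm
  isPartialOrder := F.isPartialOrder_clusterRi
  sq_of_le_of_sq := F.clusterRm_of_clusterRi_of_clusterRm hF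
  adm := F.rhoAdm
  upset_of_adm := fun _ ha => (F.mem_rhoAdm_iff.1 ha).1
  univ_adm := F.mem_rhoAdm_iff.2 ⟨fun _ _ _ _ => trivial, BooleanSubalgebra.top_mem⟩
  empty_adm := F.mem_rhoAdm_iff.2 ⟨fun _ _ h _ => h, BooleanSubalgebra.bot_mem⟩
  inter_adm := fun a ha b hb => by
    rw [mem_rhoAdm_iff] at *
    exact ⟨fun S T hS h => ⟨ha.1 S T hS.1 h, hb.1 S T hS.2 h⟩,
      BooleanSubalgebra.inf_mem ha.2 hb.2⟩
  union_adm := fun a ha b hb => by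
    rw [mem_rhoAdm_iff] at *
    exact ⟨fun S T hS h => hS.imp (ha.1 S T · h) (hb.1 S T · h),
      BooleanSubalgebra.sup_mem ha.2 hb.2⟩
  imp_adm := fun a ha b hb => by
    rw [mem_rhoAdm_iff] at *
    refine ⟨fun S T hS h U hU => hS U (F.isPartialOrder_clusterRi.trans _ _ _ h hU), ?_⟩
    rw [preimage_relImp_clusterRi]
    exact F.boxI_adm _ (BooleanSubalgebra.sup_mem (BooleanSubalgebra.compl_mem ha.2) hb.2)
  simp_adm := fun a ha b hb => by
    rw [mem_rhoAdm_iff] at *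
    refine ⟨fun S T hS h U hU => hS U (F.clusterRm_of_clusterRi_of_clusterRm hF _ _ _ h hU), ?_⟩
    rw [preimage_relImp_clusterRm F hF]
    exact F.boxM_adm _ (BooleanSubalgebra.sup_mem (BooleanSubalgebra.compl_mem ha.2) hb.2)

/-- The translation `ρ̂`: first replace `Rm` by `Rm* = Ri ∘ Rm`, then quotient by clusters. -/
def rhoHat : GenStrictFrame F.star.Cluster :=
  F.star.clusterFrame F.star_isBHL

end GenS4KFrame

/-!
A compact frame turns every proper filter of sets into a point lying in all of its admissible
members. In a general S4K-frame this yields Esakia's lemma: if `R` is tight and each member of a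
downward directed family of admissible sets meets the set of `R`-successors of `x`, then some
`R`-successor of `x` lies in all of them.

For `ρ̂`, Esakia's lemma is used twice. Applied to `Ri` and the complements of the sets `[Rm] d`
with `z ∉ d`, it shows that `Rm*` is again tight. Applied to `Rm*` and the differences `a \ b` of
admissible upsets of clusters that contain the cluster of `y`, it produces an `Rm*`-successor in
that very cluster, because admissible upsets separate clusters.

For `σ̂`, the only difficulty is compactness. As in Alexander's subbase theorem, extend a family
with the finite intersection property to an ultrafilter `U`. Compactness of the original frame gives
a point `x` such that `U` and the principal ultrafilter at `x` have the same members in `P`, and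
hence in the Boolean subalgebra generated by `P`.
-/

open Filter

section Operations

variable {X Y : Type*} {R S : X → X → Prop}

theorem relBox_mono {a b : Set X} (hab : a ⊆ b) : relBox R a ⊆ relBox R b :=
  fun _ hx y hxy => hab (hx y hxy)

theorem relBox_comp (a : Set X) : relBox (Relation.Comp R S) a = relBox R (relBox S a) :=
  Set.ext fun _ => ⟨fun h y hxy z hyz => h z ⟨y, hxy, hyz⟩, fun h z ⟨y, hxy, hyz⟩ => h y hxy z hyz⟩

theorem relBox_compl_union (a b : Set X) : relBox R (aᶜ ∪ b) = relImp R a b :=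
  Set.ext fun _ => forall₂_congr fun _ _ => imp_iff_not_or.symm

theorem relBox_subset [Std.Refl R] (a : Set X) : relBox R a ⊆ a :=
  fun x hx => hx x (refl_of R x)

theorem relUpset_relBox [IsTrans X R] (a : Set X) : RelUpset R (relBox R a) :=
  fun _ _ hx hxy z hyz => hx z (trans_of R hxy hyz)

theorem RelUpset.subset_relBox {a : Set X} (ha : RelUpset R a) : a ⊆ relBox R a :=
  fun x hx y hxy => ha x y hx hxy

theorem hasFIP_of_subset_sets {l : Filter X} [l.NeBot] {A : Set (Set X)} (hA : A ⊆ l.sets) :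
    HasFIP A :=
  generate_neBot_iff.1 (NeBot.mono ‹_› (le_generate_iff.2 hA))

theorem HasFIP.image_preimage {f : X → Y} (hf : f.Surjective) {A : Set (Set Y)} (hA : HasFIP A) :
    HasFIP (Set.preimage f '' A) := by
  intro T hTA hT
  obtain ⟨C, hCA, hC, rfl⟩ := Set.exists_subset_image_finite_and.1 ⟨T, hTA, hT, rfl⟩
  rw [Set.sInter_image, ← Set.preimage_iInter₂, ← Set.sInter_eq_biInter]
  exact (hA C hCA hC).preimage hf

theorem mem_ultrafilter_congr_of_mem_closure {P : Set (Set X)} {U V : Ultrafilter X}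
    (h : ∀ a ∈ P, a ∈ U ↔ a ∈ V) {c : Set X} (hc : c ∈ BooleanSubalgebra.closure P) :
    c ∈ U ↔ c ∈ V := by
  induction hc using BooleanSubalgebra.closure_bot_sup_induction with
  | mem a ha => exact h a ha
  | bot => exact iff_of_false U.empty_notMem V.empty_notMem
  | sup a _ b _ iha ihb =>
    exact Ultrafilter.union_mem_iff.trans ((or_congr iha ihb).trans Ultrafilter.union_mem_iff.symm)
  | compl a _ iha =>
    exact Ultrafilter.compl_mem_iff_notMem.trans
      ((not_congr iha).trans Ultrafilter.compl_mem_iff_notMem.symm)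

end Operations

namespace GenStrictFrame

variable {X : Type*} {G : GenStrictFrame X}

theorem LeRefined.le_of_forall_mem (hG : G.LeRefined) {x y : X}
    (h : ∀ a ∈ G.adm, x ∈ a → y ∈ a) : G.le x y := by
  by_contra hxy
  obtain ⟨a, ha, hx, hy⟩ := hG x y hxy
  exact hy (h a ha hx)

theorem LeRefined.eq_of_forall_mem_iff (hG : G.LeRefined) {x y : X}
    (h : ∀ a ∈ G.adm, x ∈ a ↔ y ∈ a) : x = y :=
  G.isPartialOrder.antisymm x y (hG.le_of_forall_mem fun a ha => (h a ha).1)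
    (hG.le_of_forall_mem fun a ha => (h a ha).2)

theorem Compact.exists_mem_ultrafilter_iff_mem (hG : G.Compact) (U : Ultrafilter X) :
    ∃ x, ∀ a ∈ G.adm, a ∈ U ↔ x ∈ a := by
  have hU : {a | a ∈ G.adm ∧ a ∈ U} ∪ {c | ∃ a ∈ G.adm, c = aᶜ ∧ c ∈ U} ⊆ (U : Filter X).sets := by
    rintro c (⟨-, hc⟩ | ⟨-, -, -, hc⟩) <;> exact hc
  obtain ⟨x, hx⟩ := hG {a | a ∈ G.adm ∧ a ∈ U} {c | ∃ a ∈ G.adm, c = aᶜ ∧ c ∈ U}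
    (fun _ ha => ha.1) (fun _ ⟨a, ha, hc, _⟩ => ⟨a, ha, hc⟩) (hasFIP_of_subset_sets hU)
  refine ⟨x, fun a ha => ⟨fun haU => hx a (Or.inl ⟨ha, haU⟩), fun hxa => ?_⟩⟩
  by_contra haU
  exact hx aᶜ (Or.inr ⟨a, ha, rfl, Ultrafilter.compl_mem_iff_notMem.2 haU⟩) hxa

end GenStrictFrame

namespace GenS4KFrame

variable {X : Type*} {F : GenS4KFrame X} {R S : X → X → Prop}

theorem tightFor_of_forall (h : ∀ x y, (∀ a ∈ F.adm, x ∈ relBox R a → y ∈ a) → R x y) :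
    F.TightFor R :=
  fun x y => ⟨fun hxy _ _ hx => hx y hxy, h x y⟩

theorem TightFor.exists_mem_relBox_notMem (hR : F.TightFor R) {x y : X} (hxy : ¬ R x y) :
    ∃ a ∈ F.adm, x ∈ relBox R a ∧ y ∉ a := by
  simpa [hR x y] using hxy

theorem Compact.exists_forall_mem (hF : F.Compact) (l : Filter X) [l.NeBot] :
    ∃ x, ∀ a ∈ F.adm, a ∈ l → x ∈ a := by
  obtain ⟨x, hx⟩ := hF {a | a ∈ F.adm ∧ a ∈ l} (fun _ ha => ha.1)
    (hasFIP_of_subset_sets fun _ ha => ha.2)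
  exact ⟨x, fun a ha hal => hx a ⟨ha, hal⟩⟩

theorem TightFor.exists_rel_forall_mem (hR : F.TightFor R) (hF : F.Compact) {ι : Type*}
    [Nonempty ι] {D : ι → Set X} (hDadm : ∀ i, D i ∈ F.adm) (hD : Directed (· ⊇ ·) D) {x : X}
    (hx : ∀ i, ∃ y, R x y ∧ y ∈ D i) : ∃ y, R x y ∧ ∀ i, y ∈ D i := by
  let l : Filter X := ⨅ i, 𝓟 ({y | R x y} ∩ D i)
  have hl_mem : ∀ i, {y | R x y} ∩ D i ∈ l := fun i => mem_iInf_of_mem i (mem_principal_self _)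
  have hdir : Directed (· ≥ ·) fun i => 𝓟 ({y | R x y} ∩ D i) :=
    hD.mono_comp _ (g := fun d => 𝓟 ({y | R x y} ∩ d)) fun _ _ hde =>
      principal_mono.2 (Set.inter_subset_inter_right _ hde)
  have : l.NeBot := iInf_neBot_of_directed' hdir fun i => principal_neBot_iff.2 (hx i)
  obtain ⟨y, hy⟩ := hF.exists_forall_mem l
  refine ⟨y, (hR x y).2 fun a ha hxa => hy a ha ?_, fun i => hy _ (hDadm i) ?_⟩
  · obtain ⟨i⟩ := ‹Nonempty ι›
    exact mem_of_superset (hl_mem i) fun z hz => hxa z hz.1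
  · exact mem_of_superset (hl_mem i) Set.inter_subset_right

theorem TightFor.comp (hR : F.TightFor R) (hS : F.TightFor S) (hF : F.Compact)
    (hbox : ∀ a ∈ F.adm, relBox S a ∈ F.adm) : F.TightFor (Relation.Comp R S) := by
  refine tightFor_of_forall fun x z hz => ?_
  let D : {d // d ∈ F.adm ∧ z ∉ d} → Set X := fun d => (relBox S d)ᶜ
  have : Nonempty {d // d ∈ F.adm ∧ z ∉ d} := ⟨∅, BooleanSubalgebra.bot_mem, Set.notMem_empty z⟩
  have hD : Directed (· ⊇ ·) D := fun ⟨d, hd, hzd⟩ ⟨e, he, hze⟩ =>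
    ⟨⟨d ∪ e, BooleanSubalgebra.sup_mem hd he, not_or.2 ⟨hzd, hze⟩⟩,
      Set.compl_subset_compl.2 (relBox_mono Set.subset_union_left),
      Set.compl_subset_compl.2 (relBox_mono Set.subset_union_right)⟩
  have hx : ∀ d, ∃ y, R x y ∧ y ∈ D d := by
    rintro ⟨d, hd, hzd⟩
    by_contra! hxd
    refine hzd (hz d hd ?_)
    rw [relBox_comp]
    exact fun y hxy => Set.notMem_compl_iff.1 (hxd y hxy)
  obtain ⟨y, hxy, hy⟩ := hR.exists_rel_forall_mem hF
    (fun d : {d // d ∈ F.adm ∧ z ∉ d} => BooleanSubalgebra.compl_mem (hbox d d.2.1)) hD hx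
  exact ⟨y, hxy, (hS y z).2 fun d hd hyd => by_contra fun hzd => hy ⟨d, hd, hzd⟩ hyd⟩

theorem preimage_image_toCluster {a : Set X} (ha : RelUpset F.Ri a) :
    F.toCluster ⁻¹' (F.toCluster '' a) = a := by
  refine subset_antisymm ?_ (Set.subset_preimage_image _ _)
  rintro x ⟨y, hy, hyx⟩
  exact ha y x hy (F.toCluster_eq_iff.1 hyx).1

theorem image_toCluster_mem_rhoAdm {a : Set X} (ha : RelUpset F.Ri a) (hadm : a ∈ F.adm) :
    F.toCluster '' a ∈ F.rhoAdm := by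
  rw [mem_rhoAdm_iff, preimage_image_toCluster ha]
  refine ⟨?_, hadm⟩
  rintro _ T ⟨x, hx, rfl⟩ hT
  obtain ⟨y, rfl⟩ := F.toCluster_surjective T
  exact ⟨y, ha x y hx (F.clusterRi_iff.1 hT), rfl⟩

theorem Compact.clusterFrame (hF : F.Compact) (hBHL : F.IsBHL) :
    (F.clusterFrame hBHL).Compact := by
  intro A B hA hB hAB
  have hadm : Set.preimage F.toCluster '' (A ∪ B) ⊆ (F.adm : Set (Set X)) := by
    rintro _ ⟨c, hc | hc, rfl⟩
    · exact (F.mem_rhoAdm_iff.1 (hA hc)).2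
    · obtain ⟨b, hb, rfl⟩ := hB hc
      exact BooleanSubalgebra.compl_mem (F.mem_rhoAdm_iff.1 hb).2
  obtain ⟨x, hx⟩ := hF _ hadm (hAB.image_preimage F.toCluster_surjective)
  exact ⟨F.toCluster x, fun c hc => hx _ ⟨c, hc, rfl⟩⟩

theorem TightFor.leRefined_clusterFrame (hI : F.TightFor F.Ri) (hBHL : F.IsBHL) :
    (F.clusterFrame hBHL).LeRefined := by
  intro S T hST
  obtain ⟨x, rfl⟩ := F.toCluster_surjective S
  obtain ⟨y, rfl⟩ := F.toCluster_surjective T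
  obtain ⟨a, ha, hx, hy⟩ := hI.exists_mem_relBox_notMem fun h => hST (F.clusterRi_iff.2 h)
  have hup : RelUpset F.Ri (relBox F.Ri a) := relUpset_relBox a
  refine ⟨_, image_toCluster_mem_rhoAdm hup (F.boxI_adm a ha), Set.mem_image_of_mem _ hx, ?_⟩
  rw [← Set.mem_preimage, preimage_image_toCluster hup]
  exact fun h => hy (relBox_subset a h)

theorem exists_Rm_of_toCluster_notMem_relImp (hBHL : F.IsBHL) {A B : Set F.Cluster} {x : X}
    (hx : F.toCluster x ∉ relImp F.clusterRm A B) :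
    ∃ y, F.Rm x y ∧ y ∈ F.toCluster ⁻¹' (A \ B) := by
  rw [← Set.mem_preimage, F.preimage_relImp_clusterRm hBHL, relBox_compl_union] at hx
  simpa [relImp] using hx

theorem TightFor.sqRefined_clusterFrame (hM : F.TightFor F.Rm) (hF : F.Compact) (hBHL : F.IsBHL)
    (hle : (F.clusterFrame hBHL).LeRefined) : (F.clusterFrame hBHL).SqRefined := by
  let G := F.clusterFrame hBHL
  intro S T
  obtain ⟨x, rfl⟩ := F.toCluster_surjective S
  contrapose!
  intro hsep
  let ι := {p : Set F.Cluster × Set F.Cluster // p.1 ∈ G.adm ∧ p.2 ∈ G.adm ∧ T ∈ p.1 ∧ T ∉ p.2}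
  let D : ι → Set X := fun p => F.toCluster ⁻¹' (p.1.1 \ p.1.2)
  have : Nonempty ι := ⟨⟨(Set.univ, ∅), G.univ_adm, G.empty_adm, trivial, id⟩⟩
  have hDadm : ∀ p, D p ∈ F.adm := fun ⟨_, ha, hb, _⟩ =>
    BooleanSubalgebra.sdiff_mem (F.mem_rhoAdm_iff.1 ha).2 (F.mem_rhoAdm_iff.1 hb).2
  have hD : Directed (· ⊇ ·) D := fun ⟨(a, b), ha, hb, hTa, hTb⟩ ⟨(c, d), hc, hd, hTc, hTd⟩ =>
    ⟨⟨(a ∩ c, b ∪ d), G.inter_adm a ha c hc, G.union_adm b hb d hd, ⟨hTa, hTc⟩,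
        not_or.2 ⟨hTb, hTd⟩⟩,
      Set.preimage_mono (Set.sdiff_subset_sdiff Set.inter_subset_left Set.subset_union_left),
      Set.preimage_mono (Set.sdiff_subset_sdiff Set.inter_subset_right Set.subset_union_right)⟩
  have hx : ∀ p, ∃ y, F.Rm x y ∧ y ∈ D p := fun ⟨(a, b), ha, hb, hTa, hTb⟩ =>
    exists_Rm_of_toCluster_notMem_relImp hBHL fun hxab => hTb (hsep a ha b hb hxab hTa)
  obtain ⟨y, hxy, hy⟩ := hM.exists_rel_forall_mem hF hDadm hD hx
  have hTy : T = F.toCluster y := hle.eq_of_forall_mem_iff fun a ha =>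
    ⟨fun hTa => (hy ⟨(a, ∅), ha, G.empty_adm, hTa, id⟩).1,
      fun hya => by_contra fun hTa => (hy ⟨(Set.univ, a), G.univ_adm, ha, trivial, hTa⟩).2 hya⟩
  exact ⟨x, y, rfl, hTy.symm, hxy⟩

theorem descriptive_clusterFrame (hI : F.TightFor F.Ri) (hM : F.TightFor F.Rm) (hF : F.Compact)
    (hBHL : F.IsBHL) : (F.clusterFrame hBHL).Descriptive where
  compact := hF.clusterFrame hBHL
  leRefined := hI.leRefined_clusterFrame hBHL
  sqRefined := hM.sqRefined_clusterFrame hF hBHL (hI.leRefined_clusterFrame hBHL)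

theorem descriptive_rhoHat (hI : F.TightFor F.Ri) (hM : F.TightFor F.Rm) (hF : F.Compact) :
    F.rhoHat.Descriptive :=
  descriptive_clusterFrame (F := F.star) hI (hI.comp hM hF F.boxM_adm) hF F.star_isBHL

end GenS4KFrame

namespace GenStrictFrame

variable {X : Type*} {G : GenStrictFrame X}

theorem LeRefined.differentiated_sigmaHat (hG : G.LeRefined) : G.sigmaHat.Differentiated :=
  fun _ _ => ⟨fun hxy _ _ => by rw [hxy], fun h => hG.eq_of_forall_mem_iff fun a ha =>
    h a (BooleanSubalgebra.subset_closure ha)⟩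

theorem LeRefined.tightFor_le_sigmaHat (hG : G.LeRefined) : G.sigmaHat.TightFor G.le :=
  GenS4KFrame.tightFor_of_forall fun _ _ h => hG.le_of_forall_mem fun a ha hx =>
    h a (BooleanSubalgebra.subset_closure ha) (RelUpset.subset_relBox (G.upset_of_adm a ha) hx)

theorem SqRefined.tightFor_sq_sigmaHat (hG : G.SqRefined) : G.sigmaHat.TightFor G.sq := by
  refine GenS4KFrame.tightFor_of_forall fun x y h => ?_
  by_contra hxy
  obtain ⟨a, ha, b, hb, hx, hya, hyb⟩ := hG x y hxy
  have hab : aᶜ ∪ b ∈ G.sigmaHat.adm := BooleanSubalgebra.sup_mem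
    (BooleanSubalgebra.compl_mem (BooleanSubalgebra.subset_closure ha))
    (BooleanSubalgebra.subset_closure hb)
  rw [← relBox_compl_union] at hx
  exact (h _ hab hx).elim (fun hya' => hya' hya) hyb

theorem Compact.sigmaHat (hG : G.Compact) : G.sigmaHat.Compact := by
  intro A hA hFIP
  have : (generate A).NeBot := generate_neBot_iff.2 hFIP
  let U := Ultrafilter.of (generate A)
  obtain ⟨x, hx⟩ := hG.exists_mem_ultrafilter_iff_mem U
  have hU : ∀ c ∈ G.sigmaHat.adm, c ∈ U ↔ x ∈ c :=
    fun _ => mem_ultrafilter_congr_of_mem_closure (V := pure x) hx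
  exact ⟨x, fun c hc => (hU c (hA hc)).1 (Ultrafilter.of_le _ (mem_generate_of_mem hc))⟩

theorem Descriptive.sigmaHat (hG : G.Descriptive) : G.sigmaHat.Descriptive where
  differentiated := hG.leRefined.differentiated_sigmaHat
  tightI := hG.leRefined.tightFor_le_sigmaHat
  tightM := hG.sqRefined.tightFor_sq_sigmaHat
  compact := hG.compact.sigmaHat

end GenStrictFrame

theorem mainTheorem9_general :
    (∀ {X : Type*} (F : GenS4KFrame X), F.TightFor F.Ri → F.TightFor F.Rm → F.Compact →
        F.rhoHat.Descriptive) ∧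
      (∀ {X : Type*} (G : GenStrictFrame X), G.Descriptive → G.sigmaHat.Descriptive) :=
  ⟨fun _ => GenS4KFrame.descriptive_rhoHat, fun _ => GenStrictFrame.Descriptive.sigmaHat⟩

theorem mainTheorem9 :
    (∀ {X : Type*} (F : GenS4KFrame X), F.Descriptive → F.rhoHat.Descriptive) ∧
      (∀ {X : Type*} (G : GenStrictFrame X), G.Descriptive → G.sigmaHat.Descriptive) :=
  mainTheorem9_general.imp_left fun h _ F hF => h F hF.tightI hF.tightM hF.compact
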